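/- **Theorem.** Consider the 3-body problem on the unit sphere ${\bf S}^2\subset{\bf R}^3$: bodies $q_1,q_2,q_3\in{\bf S}^2$ of masses $m_1=m_2=M>0$, $m_3=m>0$, moving according to $$m_i\ddot q_i=F_i(q)-m_i(\dot q_i\cdot\dot q_i)\,q_i,\qquad F_i(q)=\sum_{j\ne i}\frac{m_im_j\,[q_j-(q_i\cdot q_j)q_i]}{[1-(q_i\cdot q_j)^2]^{3/2}},\qquad q_i\cdot q_i=1,\quad q_i\cdot\dot q_i=0,$$ as long as $(q_i\cdot q_j)^2\neq 1$ for all $i\ne j$. For $x,y\ge 0$ with $x^2+y^2=1$ let $I(x,y)$ denote the isosceles configuration $q_1=(-x,y,0)$, $q_2=(x,y,0)$, $q_3=(0,-1,0)$ on the great circle $z=0$. The configuration $c=I(0,1)$ is collision-antipodal: two bodies coincide and the third one is antipodal to them. Let $m>0$, and consider the maximal forward solution starting at time $0$ from $I(x_0,y_0)$ with zero initial velocities, where $x_0,y_0>0$ and $x_0^2+y_0^2=1$. (i) Let $M=8m$. There is a $\delta>0$ such that if $x_0<\delta$, then the maximal solution is defined on $[0,T)$ with $0<T<\infty$, it remains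 of the form $I(x(t),y(t))$ with $x(t),y(t)>0$ and $x(t)^2+y(t)^2=1$, and it ends in a collision-antipodal singularity at time $T$: as $t\to T^-$, $q(t)\to c$, while $|\dot q_i(t)|\to\infty$ and $|F_i(q(t))|\to\infty$ for $i=1,2$; moreover $q$ has no extension that is real-analytic at $T$. (ii) Let $M=2m$. If $x_0<\sqrt2/2$ (so the initial position may be arbitrarily close to $c$), then the maximal solution is defined on $[0,\infty)$, it remains of the form $I(x(t),y(t))$ as in (i), and it is repelled from $c$: the distance from $q(t)$ to $c$ (maximum over the three bodies of the Euclidean distances) is strictly increasing on some interval $[0,\delta]$ with $\delta>0$, and it is at least its initial value for all $t\ge 0$. (iii) Let $M=4m$. If $x_0<1/\sqrt3$, then the maximal solution of the equations is defined on $[0,T)$ with $0<T<\infty$, it remains of the form $I(x(t),y(t))$ as in (i), and it reaches the collision-antipodal configuration at time $T$ with finite forces and velocities: as $t\to T^-$, $q(t)\to c$, all velocities $\dot q_i(t)$ and all forces $F_i(q(t))$ have finite limits, and the limits of $\dot q_1,\dot q_2$ are nonzero. The motion $q$ remains analytic there: it extends to a function that is real-analytic on a neighbourhood of $[0,T]$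 and takes the value $c$ at $T$. -/

import Mathlib

open Set Filter Topology

/-- A configuration of `n` bodies: the position vectors (or velocities) in `ℝ³`. -/
abbrev Config (n : ℕ) : Type := Fin n → EuclideanSpace ℝ (Fin 3)

/-- The singular set of the equations of motion on the unit sphere: two distinct bodies
coincide or are antipodal. -/
def SingularConfig {n : ℕ} (q : Config n) : Prop :=
  ∃ i j, i ≠ j ∧ (inner ℝ (q i) (q j)) ^ 2 = (1 : ℝ)

/-- The gravitational force on body `i`, i.e. the gradient with respect to `q i` of the
(degree `0` homogeneous) force function
`∑_{i<j} mass i * mass j * cot (angular distance of q i and q j)`, on the unit sphere. -/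
noncomputable def gravForce {n : ℕ} (mass : Fin n → ℝ) (q : Config n) (i : Fin n) :
    EuclideanSpace ℝ (Fin 3) :=
  ∑ j ∈ Finset.univ.erase i,
    (mass i * mass j / (1 - (inner ℝ (q i) (q j)) ^ 2) ^ (3 / 2 : ℝ)) •
      (q j - (inner ℝ (q i) (q j) : ℝ) • q i)

/-- The forward time interval `[0, T)`, where `T` may be infinite. -/
def timeDomain (T : EReal) : Set ℝ := {t | 0 ≤ t ∧ (t : EReal) < T}

/-- `(q, v)` (positions, velocities) solves the `n`-body problem on the unit sphere `S²`
on the time interval `[0, T)`. -/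
structure IsSphereSolution {n : ℕ} (mass : Fin n → ℝ) (T : EReal) (q v : ℝ → Config n) :
    Prop where
  on_sphere : ∀ t ∈ timeDomain T, ∀ i, ‖q t i‖ = 1
  tangent : ∀ t ∈ timeDomain T, ∀ i, (inner ℝ (q t i) (v t i) : ℝ) = 0
  nonsingular : ∀ t ∈ timeDomain T, ¬ SingularConfig (q t)
  deriv_pos : ∀ t ∈ timeDomain T, ∀ i,
    HasDerivWithinAt (fun s => q s i) (v t i) (timeDomain T) t
  deriv_vel : ∀ t ∈ timeDomain T, ∀ i,
    HasDerivWithinAt (fun s => v s i)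
      ((mass i)⁻¹ • gravForce mass (q t) i - (inner ℝ (v t i) (v t i) : ℝ) • q t i)
      (timeDomain T) t

/-- `(q, v)` on `[0, T)` is the maximal forward solution of the initial value problem
`q 0 = q₀`, `v 0 = v₀`: every solution with these initial data is a restriction of it. -/
structure IsMaximalSphereSolution {n : ℕ} (mass : Fin n → ℝ) (q₀ v₀ : Config n) (T : EReal)
    (q v : ℝ → Config n) : Prop where
  solution : IsSphereSolution mass T q v
  init_pos : q 0 = q₀
  init_vel : v 0 = v₀
  maximal : ∀ (T' : EReal) (q' v' : ℝ → Config n), IsSphereSolution mass T' q' v' →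
    q' 0 = q₀ → v' 0 = v₀ →
      T' ≤ T ∧ ∀ t ∈ timeDomain T', q' t = q t ∧ v' t = v t

/-- A collision-antipodal configuration of three bodies on `S²`: two bodies coincide and the
third lies at the opposite end of the corresponding diameter. -/
def IsCollisionAntipodal (c : Config 3) : Prop :=
  (∀ i, ‖c i‖ = 1) ∧
    ∃ i j k : Fin 3, i ≠ j ∧ i ≠ k ∧ j ≠ k ∧ c i = c j ∧ c k = -c i

/-- Bodies at `(-x, y, 0)`, `(x, y, 0)` and `(0, -1, 0)`. -/
noncomputable def isoscelesConfig (x y : ℝ) : Config 3 :=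
  ![!₂[-x, y, 0], !₂[x, y, 0], !₂[0, -1, 0]]

/-- An isosceles configuration on the great circle `z = 0`, with the two equal masses in the
open upper half circle, symmetric about the `y` axis. -/
def IsIsosceles (q : Config 3) : Prop :=
  ∃ x y : ℝ, 0 < x ∧ 0 < y ∧ x ^ 2 + y ^ 2 = 1 ∧ q = isoscelesConfig x y

/-- For `t ≥ 0` the motion is repelled from `c`: it starts by moving strictly away from `c`,
and it never comes closer to `c` than it was at time `0`. -/
def IsRepelledFrom (q : ℝ → Config 3) (c : Config 3) : Prop :=
  (∃ δ > 0, StrictMonoOn (fun t => dist (q t) c) (Icc 0 δ)) ∧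
    ∀ t, 0 ≤ t → dist (q 0) c ≤ dist (q t) c

/-!
The isosceles configurations on the circle `z = 0` form an invariant set: with `x = sin θ` and
`y = cos θ` the equations of motion for masses `M, M, m` reduce to the scalar equation
`θ'' = m / sin² θ - M / (4 sin² θ cos² θ)` (`gravForce_isosceles`, `isSphereSolution_isosceles`).
The energy integral turns it into a quadrature, which is regularized at the turning points (the
motion starts at one) by a suitable parameter.

* For `M = 4 b`, `m = b - a` with `a ≥ 0` and `b > 0`, the equation is
  `θ'' = - a / sin² θ - b / cos² θ`, and the bodies fall towards `θ = 0`. With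
  `tan θ = r₀ - u²` the energy integral becomes `θ' = - u A`, `u' = A (1 + tan² θ) / 2`, where
  `A² = 2 (a / (r₀ tan θ) + b)` (`hasDerivAt_fallAngle`). So the time is an increasing function of
  `u ∈ [0, √r₀)`, finite at `√r₀`. If `a > 0` (masses `8 m, 8 m, m`) then `A`, and with it the
  velocity, tends to infinity at the end, which excludes an analytic extension. If `a = 0`
  (masses `4 m, 4 m, m`) then `A` is constant, the time is an elementary function of `u`, analytic
  with positive derivative on the whole line (`exists_analytic_primitive`), and its inverse carries
  the motion analytically through the collision-antipodal configuration.
* For `M = 2 m` the equation is `θ'' = 2 m cos 2θ / sin² 2θ`, with a stable equilibrium at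
  `θ = π / 4`. With `cos 2θ = w₀ cos φ` the phase `φ` has a speed that is smooth, positive and
  bounded (`hasDerivAt_oscAngle`), so the motion is defined for all times, and the distance to the
  collision-antipodal configuration is a decreasing function of `cos φ` (`dist_oscConfig`).

That these motions are the maximal solutions among all motions of three bodies on the sphere
follows from uniqueness (`IsSphereSolution.eq_of_init_eq`), and, where the motion ends at a finite
time `T`, from the fact that a longer solution would have a singular configuration at `T`
(`IsSphereSolution.isMaximal_of_tendsto_singular`).
-/

/-! ### Uniqueness and maximality of solutions of the `n`-body problem on the sphere -/

/-- The equations of motion as a first-order vector field on pairs (positions, velocities). -/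
noncomputable def sphereField {n : ℕ} (mass : Fin n → ℝ) (z : Config n × Config n) :
    Config n × Config n :=
  (z.2, fun i => (mass i)⁻¹ • gravForce mass z.1 i - (inner ℝ (z.2 i) (z.2 i) : ℝ) • z.1 i)

/-- The field is smooth where the bodies are on the sphere and the configuration is nonsingular.
(Off the sphere `1 - ⟪q i, q j⟫ ^ 2` may be negative, and its power `3 / 2` is then zero.) -/
lemma contDiffAt_sphereField {n : ℕ} (mass : Fin n → ℝ) {z : Config n × Config n}
    (hz1 : ∀ i, ‖z.1 i‖ = 1) (hz : ¬ SingularConfig z.1) :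
    ContDiffAt ℝ 1 (sphereField mass) z := by
  have hpos : ∀ i, ContDiffAt ℝ 1 (fun z : Config n × Config n => z.1 i) z := fun i =>
    ((contDiff_apply ℝ (EuclideanSpace ℝ (Fin 3)) i).comp contDiff_fst).contDiffAt
  have hvel : ∀ i, ContDiffAt ℝ 1 (fun z : Config n × Config n => z.2 i) z := fun i =>
    ((contDiff_apply ℝ (EuclideanSpace ℝ (Fin 3)) i).comp contDiff_snd).contDiffAt
  have hforce : ∀ i, ContDiffAt ℝ 1
      (fun z : Config n × Config n => gravForce mass z.1 i) z := by
    intro i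
    unfold gravForce
    refine ContDiffAt.sum fun j hj => ?_
    have hij : ContDiffAt ℝ 1
        (fun z : Config n × Config n => (inner ℝ (z.1 i) (z.1 j) : ℝ)) z :=
      (hpos i).inner ℝ (hpos j)
    have hle : |(inner ℝ (z.1 i) (z.1 j) : ℝ)| ≤ 1 := by
      simpa [hz1] using abs_real_inner_le_norm (z.1 i) (z.1 j)
    have hgt : 0 < 1 - (inner ℝ (z.1 i) (z.1 j) : ℝ) ^ 2 :=
      sub_pos.2 (lt_of_le_of_ne (sq_le_one_iff_abs_le_one _ |>.2 hle) fun h =>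
        hz ⟨i, j, (Finset.ne_of_mem_erase hj).symm, h⟩)
    refine ContDiffAt.fun_smul ?_ ((hpos j).sub (hij.fun_smul (hpos i)))
    exact contDiffAt_const.div ((contDiffAt_const.sub (hij.pow 2)).rpow_const_of_ne hgt.ne')
      (Real.rpow_pos_of_pos hgt _).ne'
  refine contDiff_snd.contDiffAt.prodMk (contDiffAt_pi.2 fun i => ?_)
  exact (contDiffAt_const.fun_smul (hforce i)).sub (((hvel i).inner ℝ (hvel i)).fun_smul (hpos i))

lemma timeDomain_coe (T : ℝ) : timeDomain (T : EReal) = Ico 0 T := by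
  ext t; simp [timeDomain]

lemma timeDomain_top : timeDomain ⊤ = Ici 0 := by
  ext t; simp [timeDomain]

lemma timeDomain_mem_nhdsGE {T : EReal} {t : ℝ} (ht : t ∈ timeDomain T) :
    timeDomain T ∈ 𝓝[≥] t := by
  have h : Iio T ∈ 𝓝 (t : EReal) := Iio_mem_nhds ht.2
  have h' : (fun s : ℝ => (s : EReal)) ⁻¹' Iio T ∈ 𝓝 t :=
    continuous_coe_real_ereal.continuousAt h
  filter_upwards [mem_nhdsWithin_of_mem_nhds h', self_mem_nhdsWithin] with s hs hs'
  exact ⟨ht.1.trans hs', hs⟩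

lemma Icc_subset_timeDomain {T : EReal} {t : ℝ} (ht : t ∈ timeDomain T) :
    Icc 0 t ⊆ timeDomain T := fun _ hs =>
  ⟨hs.1, (EReal.coe_le_coe_iff.2 hs.2).trans_lt ht.2⟩

lemma IsSphereSolution.hasDerivWithinAt {n : ℕ} {mass : Fin n → ℝ} {T : EReal}
    {q v : ℝ → Config n} (h : IsSphereSolution mass T q v) {t : ℝ} (ht : t ∈ timeDomain T) :
    HasDerivWithinAt (fun s => (q s, v s)) (sphereField mass (q t, v t)) (timeDomain T) t :=
  HasDerivWithinAt.prodMk (hasDerivWithinAt_pi.2 fun i => h.deriv_pos t ht i)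
    (hasDerivWithinAt_pi.2 fun i => h.deriv_vel t ht i)

/-- Two solutions with the same initial data agree as long as both are defined: on a compact time
interval both trajectories stay in a compact set of nonsingular states, where the field is
Lipschitz. -/
lemma IsSphereSolution.eq_of_init_eq {n : ℕ} {mass : Fin n → ℝ} {T T' : EReal}
    {q v q' v' : ℝ → Config n} (h : IsSphereSolution mass T q v)
    (h' : IsSphereSolution mass T' q' v') (hq : q' 0 = q 0) (hv : v' 0 = v 0) {t : ℝ}
    (ht : t ∈ timeDomain T) (ht' : t ∈ timeDomain T') : q' t = q t ∧ v' t = v t := by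
  have hsub := Icc_subset_timeDomain ht
  have hsub' := Icc_subset_timeDomain ht'
  have hc : ContinuousOn (fun s => (q s, v s)) (Icc 0 t) := fun s hs =>
    ((h.hasDerivWithinAt (hsub hs)).continuousWithinAt).mono hsub
  have hc' : ContinuousOn (fun s => (q' s, v' s)) (Icc 0 t) := fun s hs =>
    ((h'.hasDerivWithinAt (hsub' hs)).continuousWithinAt).mono hsub'
  set S : Set (Config n × Config n) :=
    (fun s => (q s, v s)) '' Icc 0 t ∪ (fun s => (q' s, v' s)) '' Icc 0 t with hS
  have hScomp : IsCompact S := (isCompact_Icc.image_of_continuousOn hc).union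
    (isCompact_Icc.image_of_continuousOn hc')
  have hloc : LocallyLipschitzOn S (sphereField mass) := by
    intro z hz
    have hns : (∀ i, ‖z.1 i‖ = 1) ∧ ¬ SingularConfig z.1 := by
      rcases hz with ⟨s, hs, rfl⟩ | ⟨s, hs, rfl⟩
      · exact ⟨h.on_sphere s (hsub hs), h.nonsingular s (hsub hs)⟩
      · exact ⟨h'.on_sphere s (hsub' hs), h'.nonsingular s (hsub' hs)⟩
    obtain ⟨K, U, hU, hK⟩ := (contDiffAt_sphereField mass hns.1 hns.2).exists_lipschitzOnWith
    exact ⟨K, U, mem_nhdsWithin_of_mem_nhds hU, hK⟩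
  obtain ⟨K, hK⟩ := hloc.exists_lipschitzOnWith_of_compact hScomp
  have key := ODE_solution_unique_of_mem_Icc_right (v := fun _ => sphereField mass)
    (s := fun _ => S) (fun _ _ => hK) hc'
    (fun s hs => (h'.hasDerivWithinAt (hsub' (Ico_subset_Icc_self hs))).mono_of_mem_nhdsWithin
      (timeDomain_mem_nhdsGE (hsub' (Ico_subset_Icc_self hs))))
    (fun s hs => Or.inr (mem_image_of_mem _ (Ico_subset_Icc_self hs))) hc
    (fun s hs => (h.hasDerivWithinAt (hsub (Ico_subset_Icc_self hs))).mono_of_mem_nhdsWithin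
      (timeDomain_mem_nhdsGE (hsub (Ico_subset_Icc_self hs))))
    (fun s hs => Or.inl (mem_image_of_mem _ (Ico_subset_Icc_self hs))) (by simp [hq, hv])
  simpa using key (right_mem_Icc.2 ht.1)

lemma IsSphereSolution.isMaximal_top {n : ℕ} {mass : Fin n → ℝ} {q v : ℝ → Config n}
    (h : IsSphereSolution mass ⊤ q v) : IsMaximalSphereSolution mass (q 0) (v 0) ⊤ q v where
  solution := h
  init_pos := rfl
  init_vel := rfl
  maximal _ _ _ h' hq hv := ⟨le_top, fun _ ht =>
    h.eq_of_init_eq h' hq hv (timeDomain_top ▸ ht.1) ht⟩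

/-- A solution whose positions tend to a singular configuration at time `T` cannot be continued. -/
lemma IsSphereSolution.isMaximal_of_tendsto_singular {n : ℕ} {mass : Fin n → ℝ} {T : ℝ}
    (hT : 0 < T) {q v : ℝ → Config n} (h : IsSphereSolution mass (T : EReal) q v) {c : Config n}
    (hc : SingularConfig c) (hq : Tendsto q (𝓝[<] T) (𝓝 c)) :
    IsMaximalSphereSolution mass (q 0) (v 0) (T : EReal) q v where
  solution := h
  init_pos := rfl
  init_vel := rfl
  maximal T' q' v' h' hq0 hv0 := by
    have hle : T' ≤ T := by
      by_contra! hlt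
      have hT' : T ∈ timeDomain T' := ⟨hT.le, hlt⟩
      have hsub := Icc_subset_timeDomain hT'
      have hmem : Ico 0 T ∈ 𝓝[<] T := Ico_mem_nhdsLT hT
      have hcont : Tendsto q' (𝓝[Ico 0 T] T) (𝓝 (q' T)) :=
        (hasDerivWithinAt_pi.2 fun i => h'.deriv_pos T hT' i).continuousWithinAt.mono
          (Ico_subset_Icc_self.trans hsub)
      have hcont' : Tendsto q' (𝓝[<] T) (𝓝 (q' T)) :=
        hcont.mono_left (nhdsWithin_le_of_mem hmem)
      have heq : q =ᶠ[𝓝[<] T] q' := by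
        filter_upwards [hmem] with t ht
        exact (h.eq_of_init_eq h' hq0 hv0 (timeDomain_coe T ▸ ht)
          (hsub (Ico_subset_Icc_self ht))).1.symm
      have : q' T = c := tendsto_nhds_unique hcont' (hq.congr' heq)
      exact h'.nonsingular T hT' (this ▸ hc)
    exact ⟨hle, fun t ht => h.eq_of_init_eq h' hq0 hv0 ⟨ht.1, ht.2.trans_le hle⟩ ht⟩

/-! ### Isosceles motions on a great circle -/

/-- The unit velocities of the bodies of `isoscelesConfig x y` when the angle between the `y` axis
and the second body increases at unit speed. -/
noncomputable def isoscelesTangent (x y : ℝ) : Config 3 :=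
  ![!₂[-y, -x, 0], !₂[y, -x, 0], 0]

/-- The coefficient of `x` in `isoscelesConfig x y`. -/
noncomputable def isoscelesX : Config 3 := ![!₂[-1, 0, 0], !₂[1, 0, 0], 0]

/-- The coefficient of `y` in `isoscelesConfig x y`. -/
noncomputable def isoscelesY : Config 3 := ![!₂[0, 1, 0], !₂[0, 1, 0], 0]

lemma isoscelesConfig_eq (x y : ℝ) :
    isoscelesConfig x y = x • isoscelesX + y • isoscelesY + ![0, 0, !₂[0, -1, 0]] := by
  ext i k
  fin_cases i <;> fin_cases k <;> simp [isoscelesConfig, isoscelesX, isoscelesY]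

lemma isoscelesTangent_eq (x y : ℝ) :
    isoscelesTangent x y = y • isoscelesX - x • isoscelesY := by
  ext i k
  fin_cases i <;> fin_cases k <;> simp [isoscelesTangent, isoscelesX, isoscelesY]

lemma continuous_isoscelesConfig : Continuous fun p : ℝ × ℝ => isoscelesConfig p.1 p.2 := by
  simp only [isoscelesConfig_eq]; fun_prop

lemma continuous_isoscelesTangent : Continuous fun p : ℝ × ℝ => isoscelesTangent p.1 p.2 := by
  simp only [isoscelesTangent_eq]; fun_prop

lemma inner_fin_three (a b c a' b' c' : ℝ) :
    (inner ℝ (!₂[a, b, c] : EuclideanSpace ℝ (Fin 3)) !₂[a', b', c'] : ℝ)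
      = a * a' + b * b' + c * c' := by
  simp [PiLp.inner_apply, Fin.sum_univ_three]; ring

lemma norm_fin_three (a b c : ℝ) :
    ‖(!₂[a, b, c] : EuclideanSpace ℝ (Fin 3))‖ = √(a ^ 2 + b ^ 2 + c ^ 2) := by
  simp [EuclideanSpace.norm_eq, Fin.sum_univ_three]

lemma norm_isoscelesConfig {x y : ℝ} (h : x ^ 2 + y ^ 2 = 1) (i : Fin 3) :
    ‖isoscelesConfig x y i‖ = 1 := by
  fin_cases i <;> simp [isoscelesConfig, norm_fin_three, h]

lemma norm_isoscelesTangent {x y : ℝ} (h : x ^ 2 + y ^ 2 = 1) {i : Fin 3} (hi : i ≠ 2) :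
    ‖isoscelesTangent x y i‖ = 1 := by
  rw [add_comm] at h
  fin_cases i <;> simp_all [isoscelesTangent, norm_fin_three]

lemma not_singularConfig_isosceles {x y : ℝ} (hx : 0 < x) (hy : 0 < y) (h : x ^ 2 + y ^ 2 = 1) :
    ¬ SingularConfig (isoscelesConfig x y) := by
  have h1 : y ^ 2 ≠ 1 := by nlinarith
  have h2 : (y ^ 2 - x ^ 2) ^ 2 ≠ 1 := by
    have : (y ^ 2 - x ^ 2) ^ 2 = 1 - 4 * (x * y) ^ 2 := by
      linear_combination (x ^ 2 + y ^ 2 + 1) * h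
    have : 0 < (x * y) ^ 2 := by positivity
    linarith
  have h3 : (-(x * x) + y * y) ^ 2 ≠ 1 := by convert h2 using 2; ring
  rintro ⟨i, j, hij, hs⟩
  fin_cases i <;> fin_cases j <;>
    simp_all [isoscelesConfig, inner_fin_three]

lemma gravForce_isosceles (M m : ℝ) {x y : ℝ} (hx : 0 < x) (hy : 0 < y)
    (h : x ^ 2 + y ^ 2 = 1) :
    gravForce ![M, M, m] (isoscelesConfig x y)
      = (M * (m / x ^ 2 - M / (4 * x ^ 2 * y ^ 2))) • isoscelesTangent x y := by
  have hp : ∀ r : ℝ, 0 < r → (r ^ 2) ^ (3 / 2 : ℝ) = r ^ 3 := fun r hr => by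
    rw [← Real.rpow_natCast, ← Real.rpow_mul hr.le, ← Real.rpow_natCast]; norm_num
  have h12 : (1 - (-(x * x) + y * y) ^ 2) ^ (3 / 2 : ℝ) = (2 * x * y) ^ 3 := by
    rw [← hp _ (by positivity)]; congr 1; linear_combination (-(x ^ 2 + y ^ 2) - 1) * h
  have h3 : (1 - y ^ 2) ^ (3 / 2 : ℝ) = x ^ 3 := by
    rw [← hp _ hx]; congr 1; linarith
  have e0 : (Finset.univ.erase 0 : Finset (Fin 3)) = {1, 2} := by decide
  have e1 : (Finset.univ.erase 1 : Finset (Fin 3)) = {0, 2} := by decide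
  have e2 : (Finset.univ.erase 2 : Finset (Fin 3)) = {0, 1} := by decide
  have hx' := hx.ne'
  have hy' := hy.ne'
  have f1 : x + (-(x * x) + y * y) * x = 2 * x * y ^ 2 := by linear_combination (-x) * h
  have f1' : -x - (-(x * x) + y * y) * x = -(2 * x * y ^ 2) := by linear_combination x * h
  have f2 : y - (-(x * x) + y * y) * y = 2 * x ^ 2 * y := by linear_combination (-y) * h
  have f3 : -(M * m / x ^ 3) + M * m / x ^ 3 * (y * y) = -(M * m / x) := by
    rw [show y * y = 1 - x ^ 2 by linarith]; field_simp; ring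
  ext i k
  fin_cases i
  · simp only [gravForce, Fin.zero_eta, Fin.isValue, e0]
    fin_cases k <;>
      simp [isoscelesConfig, isoscelesTangent, inner_fin_three, h12, h3]
    · rw [f1]; field_simp; ring
    · rw [f2, f3]; field_simp; ring
  · simp only [gravForce, Fin.mk_one, Fin.isValue, e1]
    fin_cases k <;>
      simp [isoscelesConfig, isoscelesTangent, inner_fin_three, h12, h3]
    · rw [f1']; field_simp; ring
    · rw [f2, f3]; field_simp; ring
  · simp only [gravForce, Fin.reduceFinMk, Fin.isValue, e2]
    fin_cases k <;>
      simp [isoscelesConfig, isoscelesTangent, inner_fin_three, h3]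

lemma isIsosceles_sin_cos {θ : ℝ} (hθ : θ ∈ Ioo 0 (Real.pi / 2)) :
    IsIsosceles (isoscelesConfig (Real.sin θ) (Real.cos θ)) :=
  ⟨_, _, Real.sin_pos_of_pos_of_lt_pi hθ.1 (by linarith [hθ.2, Real.pi_pos]),
    Real.cos_pos_of_mem_Ioo ⟨by linarith [hθ.1, Real.pi_pos], hθ.2⟩,
    Real.sin_sq_add_cos_sq θ, rfl⟩

/-- A solution `θ` of the scalar equation
`θ'' = m / sin² θ - M / (4 sin² θ cos² θ)` yields an isosceles motion. -/
lemma isSphereSolution_isosceles {M m : ℝ} (hM : M ≠ 0) {T : EReal} {θ ω : ℝ → ℝ}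
    (hθ : ∀ t ∈ timeDomain T, θ t ∈ Ioo 0 (Real.pi / 2))
    (hθ' : ∀ t ∈ timeDomain T, HasDerivWithinAt θ (ω t) (timeDomain T) t)
    (hω' : ∀ t ∈ timeDomain T, HasDerivWithinAt ω
      (m / Real.sin (θ t) ^ 2 - M / (4 * Real.sin (θ t) ^ 2 * Real.cos (θ t) ^ 2))
      (timeDomain T) t) :
    IsSphereSolution ![M, M, m] T (fun t => isoscelesConfig (Real.sin (θ t)) (Real.cos (θ t)))
      (fun t => ω t • isoscelesTangent (Real.sin (θ t)) (Real.cos (θ t))) where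
  on_sphere t _ i := norm_isoscelesConfig (Real.sin_sq_add_cos_sq _) i
  tangent t _ i := by
    fin_cases i <;> simp [isoscelesConfig, isoscelesTangent, inner_smul_right, inner_fin_three] <;>
      right <;> ring
  nonsingular t ht := by
    obtain ⟨x, y, hx, hy, h, e⟩ := isIsosceles_sin_cos (hθ t ht)
    exact e ▸ not_singularConfig_isosceles hx hy h
  deriv_pos t ht i := by
    have hs := (Real.hasDerivAt_sin (θ t)).comp_hasDerivWithinAt t (hθ' t ht)
    have hc := (Real.hasDerivAt_cos (θ t)).comp_hasDerivWithinAt t (hθ' t ht)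
    have key := ((hs.smul_const isoscelesX).add (hc.smul_const isoscelesY)).add_const
      (![0, 0, !₂[0, -1, 0]] : Config 3)
    refine hasDerivWithinAt_pi.1 (key.congr_deriv ?_ |>.congr_of_eventuallyEq ?_ ?_) i
    · rw [isoscelesTangent_eq]; module
    · exact Eventually.of_forall fun s => isoscelesConfig_eq _ _
    · exact isoscelesConfig_eq _ _
  deriv_vel t ht i := by
    have hs := (Real.hasDerivAt_sin (θ t)).comp_hasDerivWithinAt t (hθ' t ht)
    have hc := (Real.hasDerivAt_cos (θ t)).comp_hasDerivWithinAt t (hθ' t ht)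
    have key := (hω' t ht).smul ((hc.smul_const isoscelesX).sub (hs.smul_const isoscelesY))
    have key' := hasDerivWithinAt_pi.1 (key.congr_of_eventuallyEq
      (f₁ := fun t => ω t • isoscelesTangent (Real.sin (θ t)) (Real.cos (θ t)))
      (Eventually.of_forall fun s => by simp [isoscelesTangent_eq])
      (by simp [isoscelesTangent_eq])) i
    refine key'.congr_deriv ?_
    have hsin := Real.sin_pos_of_pos_of_lt_pi (hθ t ht).1 (by linarith [(hθ t ht).2, Real.pi_pos])
    have hcos := Real.cos_pos_of_mem_Ioo (x := θ t)
      ⟨by linarith [(hθ t ht).1, Real.pi_pos], (hθ t ht).2⟩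
    have hsc := Real.sin_sq_add_cos_sq (θ t)
    have hcs := Real.cos_sq_add_sin_sq (θ t)
    rw [gravForce_isosceles M m hsin hcos hsc]
    generalize m / Real.sin (θ t) ^ 2 - M / (4 * Real.sin (θ t) ^ 2 * Real.cos (θ t) ^ 2) = g
    ext k
    fin_cases i <;> fin_cases k <;>
      simp [isoscelesConfig, isoscelesTangent, isoscelesX, isoscelesY, norm_smul, norm_fin_three,
        hcs, mul_assoc, inv_mul_cancel_left₀ hM] <;> ring

/-- The first two bodies are equally far from `(0, 1, 0)`, and the third one does not move. -/
lemma dist_isoscelesConfig {x y : ℝ} (h : x ^ 2 + y ^ 2 = 1) :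
    dist (isoscelesConfig x y) (isoscelesConfig 0 1) = √(2 - 2 * y) := by
  have h0 : ∀ i, i ≠ 2 → dist (isoscelesConfig x y i) (isoscelesConfig 0 1 i) = √(2 - 2 * y) := by
    intro i hi
    rw [EuclideanSpace.dist_eq]
    congr 1
    fin_cases i <;> simp_all [isoscelesConfig, Fin.sum_univ_three, Real.dist_eq] <;> nlinarith
  refine le_antisymm ((dist_pi_le_iff (Real.sqrt_nonneg _)).2 fun i => ?_) ?_
  · by_cases hi : i = 2
    · subst hi; simp [isoscelesConfig]
    · exact (h0 i hi).le
  · rw [← h0 0 (by decide)]; exact dist_le_pi_dist _ _ 0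

/-! ### Inverting a quadrature -/

section Quadrature

variable {G k : ℝ → ℝ} {S : Set ℝ} {c R : ℝ}

/-- The inverse `u` of `G` solves `u' = 1 / G'(u)`. -/
lemma hasDerivAt_invFunOn (hS : IsOpen S) (hinj : InjOn G S) {g : ℝ}
    (hG : HasStrictDerivAt G g c) (hg : g ≠ 0) (hc : c ∈ S) :
    HasDerivAt (Function.invFunOn G S) g⁻¹ (G c) := by
  have hid : Function.invFunOn G S ∘ G =ᶠ[𝓝 c] id := by
    filter_upwards [hS.mem_nhds hc] with x hx using hinj.leftInvOn_invFunOn hx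
  have huc : Function.invFunOn G S (G c) = c := hinj.leftInvOn_invFunOn hc
  have hmap := hG.map_nhds_eq hg
  have hcont : ContinuousAt (Function.invFunOn G S) (G c) := by
    rw [ContinuousAt, huc, Tendsto, ← hmap, Filter.map_map, Filter.map_congr hid, Filter.map_id]
  refine HasDerivAt.of_local_left_inverse hcont (by simpa [huc] using hG.hasDerivAt) hg ?_
  rw [← hmap, Filter.eventually_map]
  filter_upwards [hid] with x hx
  exact congrArg G hx

lemma analyticAt_invFunOn (hS : IsOpen S) (hinj : InjOn G S) (hG : AnalyticAt ℝ G c)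
    (hg : deriv G c ≠ 0) (hc : c ∈ S) : AnalyticAt ℝ (Function.invFunOn G S) (G c) := by
  rw [← analyticAt_comp_iff_of_deriv_ne_zero hG hg]
  refine analyticAt_id.congr ?_
  filter_upwards [hS.mem_nhds hc] with x hx using (hinj.leftInvOn_invFunOn hx).symm

lemma exists_mem_Ico_eq (hR : 0 < R) (hcont : ContinuousOn G (Icc 0 R)) (h0 : G 0 = 0) {t : ℝ}
    (ht : t ∈ Ico 0 (G R)) : ∃ c ∈ Ico 0 R, G c = t :=
  intermediate_value_Ico hR.le hcont (by rwa [h0])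

lemma tendsto_invFunOn (hinj : InjOn G S) (hSR : Ico 0 R ⊆ S) (hR : 0 < R)
    (hmono : StrictMonoOn G (Icc 0 R)) (hcont : ContinuousOn G (Icc 0 R)) (h0 : G 0 = 0) :
    Tendsto (Function.invFunOn G S) (𝓝[<] G R) (𝓝[<] R) := by
  have hR' : R ∈ Icc 0 R := right_mem_Icc.2 hR.le
  have h0' : (0 : ℝ) ∈ Icc 0 R := left_mem_Icc.2 hR.le
  have hev : ∀ l ∈ Ico 0 R, ∀ᶠ t in 𝓝[<] G R, Function.invFunOn G S t ∈ Ioo l R := by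
    intro l hl
    have hlR := hmono (Ico_subset_Icc_self hl) hR' hl.2
    filter_upwards [Ioo_mem_nhdsLT hlR] with t ht
    have h0l : 0 ≤ G l := h0 ▸ hmono.monotoneOn h0' (Ico_subset_Icc_self hl) hl.1
    obtain ⟨c, hc, rfl⟩ := exists_mem_Ico_eq hR hcont h0 ⟨h0l.trans ht.1.le, ht.2⟩
    rw [hinj.leftInvOn_invFunOn (hSR hc)]
    exact ⟨(hmono.lt_iff_lt (Ico_subset_Icc_self hl) (Ico_subset_Icc_self hc)).1 ht.1, hc.2⟩
  refine tendsto_nhdsWithin_iff.2 ⟨tendsto_order.2 ⟨fun l hl => ?_, fun l hl => ?_⟩, ?_⟩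
  · filter_upwards [hev (max l 0) ⟨le_max_right _ _, max_lt hl hR⟩] with t ht
    exact (le_max_left _ _).trans_lt ht.1
  · filter_upwards [hev 0 ⟨le_rfl, hR⟩] with t ht using ht.2.trans hl
  · filter_upwards [hev 0 ⟨le_rfl, hR⟩] with t ht using ht.2

end Quadrature

/-! ### Falling motions: `θ'' = - a / sin² θ - b / cos² θ` -/

lemma sin_arctan_sq_inv {r : ℝ} (hr : 0 < r) :
    1 / Real.sin (Real.arctan r) ^ 2 = (1 + r ^ 2) / r ^ 2 := by
  rw [Real.sin_arctan, div_pow, Real.sq_sqrt (by positivity), one_div_div]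

lemma cos_arctan_sq_inv (r : ℝ) : 1 / Real.cos (Real.arctan r) ^ 2 = 1 + r ^ 2 := by
  rw [Real.cos_sq_arctan, one_div_one_div]

/-- The angle of a falling motion released at `tan θ = r₀`, in terms of the regularizing
parameter `u = √(r₀ - tan θ)`. -/
noncomputable def fallAngle (r₀ u : ℝ) : ℝ := Real.arctan (r₀ - u ^ 2)

/-- The factor `A` in the energy integral `θ' = - u A` of a falling motion. -/
noncomputable def fallSpeed (a b r₀ u : ℝ) : ℝ := √(2 * (a / ((r₀ - u ^ 2) * r₀) + b))

/-- The derivative of the time with respect to the regularizing parameter. -/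
noncomputable def fallTime (a b r₀ u : ℝ) : ℝ :=
  2 / ((1 + (r₀ - u ^ 2) ^ 2) * fallSpeed a b r₀ u)

lemma fallSpeed_pos {a b r₀ u : ℝ} (ha : 0 ≤ a) (hb : 0 < b) (hr₀ : 0 < r₀)
    (hr : 0 < r₀ - u ^ 2) : 0 < fallSpeed a b r₀ u :=
  Real.sqrt_pos.2 (by positivity)

/-- If the regularizing parameter runs at speed `1 / fallTime`, the angle satisfies the equation of
a falling motion. -/
lemma hasDerivAt_fallAngle {a b r₀ t : ℝ} {u : ℝ → ℝ} (ha : 0 ≤ a) (hb : 0 < b) (hr₀ : 0 < r₀)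
    (hr : 0 < r₀ - u t ^ 2) (hu : HasDerivAt u (fallTime a b r₀ (u t))⁻¹ t) :
    HasDerivAt (fun s => fallAngle r₀ (u s)) (-(u t * fallSpeed a b r₀ (u t))) t ∧
    HasDerivAt (fun s => -(u s * fallSpeed a b r₀ (u s)))
      (-(a / Real.sin (fallAngle r₀ (u t)) ^ 2) - b / Real.cos (fallAngle r₀ (u t)) ^ 2) t := by
  have hA := fallSpeed_pos ha hb hr₀ hr
  have hA2 : fallSpeed a b r₀ (u t) ^ 2 = 2 * (a / ((r₀ - u t ^ 2) * r₀) + b) :=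
    Real.sq_sqrt (by positivity)
  have hr1 := ((hu.fun_pow 2).const_sub r₀)
  have hB := (((hr1.mul_const r₀).fun_inv (by positivity)).const_mul a).add_const b |>.const_mul 2
  have hB' := hB.sqrt (by positivity)
  have hsp : (fun s => √(2 * (a * ((r₀ - u s ^ 2) * r₀)⁻¹ + b)))
      = fun s => fallSpeed a b r₀ (u s) := by
    ext s; simp [fallSpeed, div_eq_mul_inv]
  have hsp' : √(2 * (a * ((r₀ - u t ^ 2) * r₀)⁻¹ + b)) = fallSpeed a b r₀ (u t) := by
    simp [fallSpeed, div_eq_mul_inv]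
  rw [hsp, hsp'] at hB'
  have h1 := hr1.arctan
  have h2 := (hu.fun_mul hB').fun_neg
  refine ⟨h1.congr_deriv ?_, h2.congr_deriv ?_⟩
  · simp only [fallTime]
    field_simp
    push_cast; ring
  · rw [div_eq_mul_one_div a, div_eq_mul_one_div b, fallAngle, sin_arctan_sq_inv hr,
      cos_arctan_sq_inv]
    simp only [fallTime]
    set A := fallSpeed a b r₀ (u t)
    set r := r₀ - u t ^ 2 with hrdef
    have hu2 : u t ^ 2 = r₀ - r := by rw [hrdef]; ring
    have hstep : -((2 / ((1 + r ^ 2) * A))⁻¹ * A +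
        u t * (2 * (a * (-(-(((2 : ℕ) : ℝ) * u t ^ (2 - 1) * (2 / ((1 + r ^ 2) * A))⁻¹) * r₀) /
          (r * r₀) ^ 2)) / (2 * A)))
        = -((1 + r ^ 2) / 2 * A ^ 2 + a * u t ^ 2 * (1 + r ^ 2) / (r ^ 2 * r₀)) := by
      field_simp; push_cast; ring
    rw [hstep, hA2, hu2]
    field_simp; ring

lemma fallAngle_mem {r₀ u : ℝ} (hr : 0 < r₀ - u ^ 2) :
    fallAngle r₀ u ∈ Ioo 0 (Real.pi / 2) :=
  ⟨Real.arctan_pos.2 hr, Real.arctan_lt_pi_div_two _⟩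

lemma sin_arctan_div {x y : ℝ} (hy : 0 < y) (h : x ^ 2 + y ^ 2 = 1) :
    Real.sin (Real.arctan (x / y)) = x := by
  rw [Real.sin_arctan, show 1 + (x / y) ^ 2 = (1 / y) ^ 2 by field_simp; linarith,
    Real.sqrt_sq (by positivity)]
  field_simp

lemma cos_arctan_div {x y : ℝ} (hy : 0 < y) (h : x ^ 2 + y ^ 2 = 1) :
    Real.cos (Real.arctan (x / y)) = y := by
  rw [Real.cos_arctan, show 1 + (x / y) ^ 2 = (1 / y) ^ 2 by field_simp; linarith,
    Real.sqrt_sq (by positivity)]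
  field_simp

lemma sub_sq_pos_of_mem_Ico {r₀ u : ℝ} (hu : u ∈ Ico 0 √r₀) :
    0 < r₀ - u ^ 2 := by
  have := (Real.lt_sqrt hu.1).1 hu.2
  linarith

/-- The positions along a falling motion. -/
noncomputable def fallConfig (r₀ u : ℝ) : Config 3 :=
  isoscelesConfig (Real.sin (fallAngle r₀ u)) (Real.cos (fallAngle r₀ u))

/-- The velocities along a falling motion. -/
noncomputable def fallVelocity (a b r₀ u : ℝ) : Config 3 :=
  (-(u * fallSpeed a b r₀ u)) •
    isoscelesTangent (Real.sin (fallAngle r₀ u)) (Real.cos (fallAngle r₀ u))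

lemma continuous_fallAngle (r₀ : ℝ) : Continuous (fallAngle r₀) :=
  Real.continuous_arctan.comp (by fun_prop)

lemma continuous_fallConfig (r₀ : ℝ) : Continuous (fallConfig r₀) :=
  continuous_isoscelesConfig.comp
    ((Real.continuous_sin.comp (continuous_fallAngle r₀)).prodMk
      (Real.continuous_cos.comp (continuous_fallAngle r₀)))

lemma fallAngle_sqrt {r₀ : ℝ} (hr₀ : 0 < r₀) : fallAngle r₀ √r₀ = 0 := by
  simp [fallAngle, Real.sq_sqrt hr₀.le]

lemma fallConfig_sqrt {r₀ : ℝ} (hr₀ : 0 < r₀) : fallConfig r₀ √r₀ = isoscelesConfig 0 1 := by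
  simp [fallConfig, fallAngle_sqrt hr₀]

lemma isIsosceles_fallConfig {r₀ u : ℝ} (hr : 0 < r₀ - u ^ 2) : IsIsosceles (fallConfig r₀ u) :=
  isIsosceles_sin_cos (fallAngle_mem hr)

lemma isCollisionAntipodal_isosceles : IsCollisionAntipodal (isoscelesConfig 0 1) := by
  refine ⟨norm_isoscelesConfig (by norm_num), 0, 1, 2, by decide, by decide, by decide, ?_, ?_⟩
  · simp [isoscelesConfig]
  · ext k; fin_cases k <;> simp [isoscelesConfig]

lemma singularConfig_isosceles : SingularConfig (isoscelesConfig 0 1) :=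
  ⟨0, 1, by decide, by simp [isoscelesConfig, norm_fin_three]⟩

/-- With masses `M = 4 b` and `m = b - a` the fall ends at the time at which the regularizing
parameter reaches `√r₀`, and the motion is maximal. -/
lemma isMaximal_fall {M m a b x₀ y₀ T : ℝ} {u : ℝ → ℝ} (ha : 0 ≤ a) (hb : 0 < b)
    (hM : M = 4 * b) (hm : m = b - a) (hx₀ : 0 < x₀) (hy₀ : 0 < y₀)
    (h : x₀ ^ 2 + y₀ ^ 2 = 1) (hT : 0 < T) (hu0 : u 0 = 0)
    (hmem : ∀ t ∈ Ico 0 T, u t ∈ Ico 0 √(x₀ / y₀))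
    (hu : ∀ t ∈ Ico 0 T, HasDerivAt u (fallTime a b (x₀ / y₀) (u t))⁻¹ t)
    (hlim : Tendsto u (𝓝[<] T) (𝓝[<] √(x₀ / y₀))) :
    IsMaximalSphereSolution ![M, M, m] (isoscelesConfig x₀ y₀) 0 (T : EReal)
      (fun t => fallConfig (x₀ / y₀) (u t)) (fun t => fallVelocity a b (x₀ / y₀) (u t)) ∧
    Tendsto (fun t => fallConfig (x₀ / y₀) (u t)) (𝓝[<] T) (𝓝 (isoscelesConfig 0 1)) := by
  have hr₀ : 0 < x₀ / y₀ := by positivity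
  have hr : ∀ t ∈ Ico 0 T, 0 < x₀ / y₀ - u t ^ 2 := fun t ht =>
    sub_sq_pos_of_mem_Ico (hmem t ht)
  have hq : Tendsto (fun t => fallConfig (x₀ / y₀) (u t)) (𝓝[<] T) (𝓝 (isoscelesConfig 0 1)) := by
    rw [← fallConfig_sqrt hr₀]
    exact ((continuous_fallConfig _).tendsto _).comp (hlim.mono_right nhdsWithin_le_nhds)
  have hsol : IsSphereSolution ![M, M, m] (T : EReal) (fun t => fallConfig (x₀ / y₀) (u t))
      (fun t => fallVelocity a b (x₀ / y₀) (u t)) := by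
    refine isSphereSolution_isosceles (θ := fun t => fallAngle (x₀ / y₀) (u t))
      (by rw [hM]; positivity) ?_ ?_ ?_ <;> rw [timeDomain_coe] <;> intro t ht
    · exact fallAngle_mem (hr t ht)
    · exact (hasDerivAt_fallAngle ha hb hr₀ (hr t ht) (hu t ht)).1.hasDerivWithinAt
    · refine (hasDerivAt_fallAngle ha hb hr₀ (hr t ht) (hu t ht)).2.hasDerivWithinAt.congr_deriv ?_
      obtain ⟨h0, h1⟩ := fallAngle_mem (hr t ht)
      have hsin := Real.sin_pos_of_pos_of_lt_pi h0 (by linarith [Real.pi_pos])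
      have hcos := Real.cos_pos_of_mem_Ioo ⟨by linarith [Real.pi_pos], h1⟩
      have hs2 : Real.sin (fallAngle (x₀ / y₀) (u t)) ^ 2
          = 1 - Real.cos (fallAngle (x₀ / y₀) (u t)) ^ 2 := Real.sin_sq _
      have hc2 : 1 - Real.cos (fallAngle (x₀ / y₀) (u t)) ^ 2 ≠ 0 := by rw [← hs2]; positivity
      rw [hM, hm, hs2]
      field_simp
      ring
  refine ⟨?_, hq⟩
  have := hsol.isMaximal_of_tendsto_singular hT singularConfig_isosceles hq
  simpa [hu0, fallConfig, fallVelocity, fallAngle, sin_arctan_div hy₀ h, cos_arctan_div hy₀ h]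
    using this

/-! ### Masses `8 m, 8 m, m`: collision-antipodal singularity -/

/-- A solution with unbounded velocities at `T` has no analytic continuation to `T`. -/
lemma IsSphereSolution.not_analyticAt_of_tendsto {n : ℕ} {mass : Fin n → ℝ} {T : ℝ} (hT : 0 < T)
    {q v : ℝ → Config n} (h : IsSphereSolution mass (T : EReal) q v) {i : Fin n}
    (hv : Tendsto (fun t => ‖v t i‖) (𝓝[<] T) atTop) :
    ¬ ∃ Q : ℝ → Config n, AnalyticAt ℝ Q T ∧ Q =ᶠ[𝓝[<] T] q := by
  rintro ⟨Q, hQ, hQq⟩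
  have hQ' : ContinuousAt (fun t => ‖deriv Q t i‖) T :=
    ((continuous_apply i).continuousAt.comp hQ.deriv.continuousAt).norm
  refine not_tendsto_nhds_of_tendsto_atTop hv ‖deriv Q T i‖
    ((hQ'.tendsto.mono_left nhdsWithin_le_nhds).congr' ?_)
  filter_upwards [eventually_eventually_nhdsWithin.2 hQq, Ioo_mem_nhdsLT hT] with t ht htT
  rw [isOpen_Iio.nhdsWithin_eq htT.2] at ht
  have hder : HasDerivAt q (v t) t :=
    (hasDerivWithinAt_pi.2 fun i => h.deriv_pos t
      (by rw [timeDomain_coe]; exact Ioo_subset_Ico_self htT) i).hasDerivAt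
      (by rw [timeDomain_coe]; exact Ico_mem_nhds htT.1 htT.2)
  rw [(hder.congr_of_eventuallyEq ht).deriv]

lemma tendsto_sub_sq {r₀ : ℝ} (hr₀ : 0 < r₀) :
    Tendsto (fun u : ℝ => r₀ - u ^ 2) (𝓝[<] √r₀) (𝓝[>] 0) := by
  refine tendsto_nhdsWithin_iff.2 ⟨?_, ?_⟩
  · have : Continuous fun u : ℝ => r₀ - u ^ 2 := by fun_prop
    exact (this.tendsto' _ _ (by simp [Real.sq_sqrt hr₀.le])).mono_left nhdsWithin_le_nhds
  · filter_upwards [Ioo_mem_nhdsLT (Real.sqrt_pos.2 hr₀)] with u hu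
    exact sub_sq_pos_of_mem_Ico (Ioo_subset_Ico_self hu)

lemma tendsto_mul_fallSpeed {a b r₀ : ℝ} (ha : 0 < a) (hr₀ : 0 < r₀) :
    Tendsto (fun u => u * fallSpeed a b r₀ u) (𝓝[<] √r₀) atTop := by
  refine Tendsto.pos_mul_atTop (Real.sqrt_pos.2 hr₀)
    (tendsto_id.mono_left nhdsWithin_le_nhds) (Real.tendsto_sqrt_atTop.comp ?_)
  have h1 := tendsto_inv_nhdsGT_zero.comp (tendsto_sub_sq hr₀)
  have h2 := tendsto_atTop_add_const_right _ b (h1.const_mul_atTop (div_pos ha hr₀))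
  refine (h2.const_mul_atTop two_pos).congr fun u => ?_
  simp only [Function.comp]
  congr 2
  rw [div_mul_eq_div_div_swap, div_eq_mul_inv (a / r₀)]

lemma norm_fallVelocity {a b r₀ u : ℝ} (hu : 0 ≤ u) {i : Fin 3} (hi : i ≠ 2) :
    ‖fallVelocity a b r₀ u i‖ = u * fallSpeed a b r₀ u := by
  rw [fallVelocity, Pi.smul_apply, norm_smul, norm_isoscelesTangent (Real.sin_sq_add_cos_sq _) hi,
    mul_one, Real.norm_eq_abs, abs_neg, abs_of_nonneg (mul_nonneg hu (by exact Real.sqrt_nonneg _))]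

lemma gravForce_fallConfig (M m : ℝ) {r₀ u : ℝ} (hr : 0 < r₀ - u ^ 2) :
    gravForce ![M, M, m] (fallConfig r₀ u) =
      (M * (m / Real.sin (fallAngle r₀ u) ^ 2
        - M / (4 * Real.sin (fallAngle r₀ u) ^ 2 * Real.cos (fallAngle r₀ u) ^ 2))) •
      isoscelesTangent (Real.sin (fallAngle r₀ u)) (Real.cos (fallAngle r₀ u)) := by
  obtain ⟨h0, h1⟩ := fallAngle_mem hr
  exact gravForce_isosceles M m (Real.sin_pos_of_pos_of_lt_pi h0 (by linarith [Real.pi_pos]))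
    (Real.cos_pos_of_mem_Ioo ⟨by linarith [Real.pi_pos], h1⟩) (Real.sin_sq_add_cos_sq _)

/-- The force grows at least like the inverse square of `tan θ`. -/
lemma le_norm_gravForce_fallConfig {m r₀ u : ℝ} (hm : 0 < m) (hr : 0 < r₀ - u ^ 2) {i : Fin 3}
    (hi : i ≠ 2) : 8 * m ^ 2 * ((r₀ - u ^ 2) ^ 2)⁻¹
      ≤ ‖gravForce ![8 * m, 8 * m, m] (fallConfig r₀ u) i‖ := by
  rw [gravForce_fallConfig _ _ hr, Pi.smul_apply, norm_smul,
    norm_isoscelesTangent (Real.sin_sq_add_cos_sq _) hi, mul_one, Real.norm_eq_abs]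
  refine le_trans ?_ (neg_le_abs _)
  have hs := sin_arctan_sq_inv hr
  have hc := cos_arctan_sq_inv (r₀ - u ^ 2)
  have e : -(8 * m * (m / Real.sin (fallAngle r₀ u) ^ 2
        - 8 * m / (4 * Real.sin (fallAngle r₀ u) ^ 2 * Real.cos (fallAngle r₀ u) ^ 2)))
      = 8 * m ^ 2 * ((1 / Real.sin (fallAngle r₀ u) ^ 2)
        * (2 * (1 / Real.cos (fallAngle r₀ u) ^ 2) - 1)) := by ring
  rw [e, fallAngle, hs, hc]
  refine mul_le_mul_of_nonneg_left ?_ (by positivity)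
  rw [div_mul_eq_mul_div, ← one_div]
  gcongr
  nlinarith [sq_nonneg (r₀ - u ^ 2), mul_nonneg (sq_nonneg (r₀ - u ^ 2)) (sq_nonneg (r₀ - u ^ 2))]

/-- For `a > 0` the time quadrature has a continuous integrand that vanishes at the end `√r₀`, so
the fall takes a finite time. -/
lemma exists_fall_parameter {a b r₀ : ℝ} (ha : 0 < a) (hb : 0 < b) (hr₀ : 0 < r₀) :
    ∃ T : ℝ, 0 < T ∧ ∃ u : ℝ → ℝ, u 0 = 0 ∧ (∀ t ∈ Ico 0 T, u t ∈ Ico 0 √r₀) ∧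
      (∀ t ∈ Ico 0 T, HasDerivAt u (fallTime a b r₀ (u t))⁻¹ t) ∧
      Tendsto u (𝓝[<] T) (𝓝[<] √r₀) := by
  set R := √r₀ with hRdef
  have hR : 0 < R := Real.sqrt_pos.2 hr₀
  -- `fallTime` with numerator and denominator multiplied by `√(tan θ * r₀)`, and extended by zero
  -- past the end of the fall, so as to be continuous on the whole line.
  set k : ℝ → ℝ := fun c => 2 * √(max (r₀ - c ^ 2) 0 * r₀) /
    ((1 + (r₀ - c ^ 2) ^ 2) * √(2 * (a + b * (max (r₀ - c ^ 2) 0 * r₀)))) with hk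
  have hden : ∀ c : ℝ, 0 < √(2 * (a + b * (max (r₀ - c ^ 2) 0 * r₀))) := fun c =>
    Real.sqrt_pos.2 (by have := le_max_right (r₀ - c ^ 2) 0; positivity)
  have hkc : Continuous k := by
    refine Continuous.div (by fun_prop) (by fun_prop) fun c => ?_
    have := hden c
    positivity
  have hrpos : ∀ c ∈ Ioo (-R) R, 0 < r₀ - c ^ 2 := fun c hc => by
    have := sq_lt_sq' hc.1 hc.2
    rw [hRdef, Real.sq_sqrt hr₀.le] at this
    linarith
  have hkpos : ∀ c ∈ Ioo (-R) R, 0 < k c := fun c hc => by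
    have := hrpos c hc
    have := hden c
    have : 0 < √(max (r₀ - c ^ 2) 0 * r₀) :=
      Real.sqrt_pos.2 (mul_pos (lt_max_of_lt_left (hrpos c hc)) hr₀)
    positivity
  have hkeq : ∀ c ∈ Ioo (-R) R, k c = fallTime a b r₀ c := fun c hc => by
    have hr := hrpos c hc
    have hd := hden c
    have hsp : fallSpeed a b r₀ c
        = √(2 * (a + b * ((r₀ - c ^ 2) * r₀))) / √((r₀ - c ^ 2) * r₀) := by
      rw [fallSpeed, ← Real.sqrt_div (by positivity)]
      congr 1; field_simp
    have : 0 < √((r₀ - c ^ 2) * r₀) := Real.sqrt_pos.2 (by positivity)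
    simp only [hk, fallTime, hsp]
    rw [max_eq_left hr.le] at hd ⊢
    field_simp
  set G : ℝ → ℝ := fun c => ∫ x in (0 : ℝ)..c, k x with hGdef
  have hG : ∀ c, HasStrictDerivAt G (k c) c := fun c => hkc.integral_hasStrictDerivAt 0 c
  have hGc : Continuous G := continuous_iff_continuousAt.2 fun c => (hG c).hasDerivAt.continuousAt
  have h0 : G 0 = 0 := by simp [hGdef]
  have hmono : StrictMonoOn G (Icc (-R) R) :=
    strictMonoOn_of_deriv_pos (convex_Icc _ _) hGc.continuousOn fun c hc => by
      rw [(hG c).hasDerivAt.deriv]; rw [interior_Icc] at hc; exact hkpos c hc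
  have hinj : InjOn G (Ioo (-R) R) := hmono.injOn.mono Ioo_subset_Icc_self
  have hsub : Ico 0 R ⊆ Ioo (-R) R := fun c hc => ⟨by linarith [hc.1], hc.2⟩
  have hmono' : StrictMonoOn G (Icc 0 R) := hmono.mono (Icc_subset_Icc_left (by linarith))
  have hmem0 : (0 : ℝ) ∈ Ico 0 R := ⟨le_rfl, hR⟩
  refine ⟨G R, ?_, Function.invFunOn G (Ioo (-R) R), ?_, fun t ht => ?_, fun t ht => ?_, ?_⟩
  · rw [← h0]; exact hmono' (left_mem_Icc.2 hR.le) (right_mem_Icc.2 hR.le) hR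
  · conv_lhs => rw [← h0]
    exact hinj.leftInvOn_invFunOn (hsub hmem0)
  · obtain ⟨c, hc, rfl⟩ := exists_mem_Ico_eq hR hGc.continuousOn h0 ht
    rwa [hinj.leftInvOn_invFunOn (hsub hc)]
  · obtain ⟨c, hc, rfl⟩ := exists_mem_Ico_eq hR hGc.continuousOn h0 ht
    rw [hinj.leftInvOn_invFunOn (hsub hc), ← hkeq c (hsub hc)]
    exact hasDerivAt_invFunOn isOpen_Ioo hinj (hG c) (hkpos c (hsub hc)).ne' (hsub hc)
  · exact tendsto_invFunOn hinj hsub hR hmono' hGc.continuousOn h0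

lemma exists_fall_into_singularity {m x₀ y₀ : ℝ} (hm : 0 < m) (hx₀ : 0 < x₀) (hy₀ : 0 < y₀)
    (h : x₀ ^ 2 + y₀ ^ 2 = 1) :
    ∃ T : ℝ, 0 < T ∧ ∃ q v : ℝ → Config 3,
      IsMaximalSphereSolution ![8 * m, 8 * m, m] (isoscelesConfig x₀ y₀) 0 (T : EReal) q v ∧
      (∀ t ∈ Ico 0 T, IsIsosceles (q t)) ∧
      Tendsto q (𝓝[<] T) (𝓝 (isoscelesConfig 0 1)) ∧
      (∀ i : Fin 3, i ≠ 2 →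
        Tendsto (fun t => ‖v t i‖) (𝓝[<] T) atTop ∧
        Tendsto (fun t => ‖gravForce ![8 * m, 8 * m, m] (q t) i‖) (𝓝[<] T) atTop) ∧
      ¬ ∃ Q : ℝ → Config 3, AnalyticAt ℝ Q T ∧ Q =ᶠ[𝓝[<] T] q := by
  have hr₀ : 0 < x₀ / y₀ := by positivity
  obtain ⟨T, hT, u, hu0, hmem, hu, hlim⟩ :=
    exists_fall_parameter hm (b := 2 * m) (by positivity) hr₀
  obtain ⟨hmax, hq⟩ := isMaximal_fall (M := 8 * m) (m := m) hm.le (by positivity) (by ring)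
    (by ring) hx₀ hy₀ h hT hu0 hmem hu hlim
  have hIco : Ico 0 T ∈ 𝓝[<] T := Ico_mem_nhdsLT hT
  have hv : ∀ i : Fin 3, i ≠ 2 →
      Tendsto (fun t => ‖fallVelocity m (2 * m) (x₀ / y₀) (u t) i‖) (𝓝[<] T) atTop := by
    intro i hi
    refine ((tendsto_mul_fallSpeed (b := 2 * m) hm hr₀).comp hlim).congr' ?_
    filter_upwards [hIco] with t ht
    exact (norm_fallVelocity (hmem t ht).1 hi).symm
  refine ⟨T, hT, _, _, hmax, fun t ht => isIsosceles_fallConfig (sub_sq_pos_of_mem_Ico (hmem t ht)),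
    hq, fun i hi => ⟨hv i hi, ?_⟩, hmax.solution.not_analyticAt_of_tendsto hT (hv 0 (by decide))⟩
  have hF : Tendsto (fun t => 8 * m ^ 2 * ((x₀ / y₀ - u t ^ 2) ^ 2)⁻¹) (𝓝[<] T) atTop := by
    have := (tendsto_pow_atTop (n := 2) two_ne_zero).comp
      (tendsto_inv_nhdsGT_zero.comp ((tendsto_sub_sq hr₀).comp hlim))
    refine (this.const_mul_atTop (by positivity : 0 < 8 * m ^ 2)).congr fun t => ?_
    simp
  refine tendsto_atTop_mono' _ ?_ hF
  filter_upwards [hIco] with t ht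
  exact le_norm_gravForce_fallConfig hm (sub_sq_pos_of_mem_Ico (hmem t ht)) hi

/-! ### Masses `4 m, 4 m, m`: analytic passage -/

/-- The primitive is elementary: with `β ^ 2 = r₀ - i` it is the imaginary part of
`(log (β + c) - log (β - c)) / (2 β)`. -/
lemma exists_analytic_primitive (r₀ : ℝ) : ∃ F : ℝ → ℝ, F 0 = 0 ∧ (∀ c, AnalyticAt ℝ F c) ∧
    ∀ c, HasDerivAt F (1 / (1 + (r₀ - c ^ 2) ^ 2)) c := by
  obtain ⟨β, hβ⟩ := IsAlgClosed.exists_pow_nat_eq ((r₀ : ℂ) - Complex.I) two_pos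
  have him : β.im ≠ 0 := by
    intro h0
    have := congrArg Complex.im hβ
    simp [pow_two, h0] at this
  have hβ0 : β ≠ 0 := fun h0 => him (by simp [h0])
  have hadd : ∀ c : ℝ, β + c ∈ Complex.slitPlane := fun c => Or.inr (by simpa using him)
  have hsub : ∀ c : ℝ, β - c ∈ Complex.slitPlane := fun c => Or.inr (by simpa using him)
  set f : ℂ → ℂ := fun z => (Complex.log (β + z) - Complex.log (β - z)) / (2 * β) with hf
  refine ⟨fun c => (f c).im, by simp [hf], fun c => ?_, fun c => ?_⟩
  · refine AnalyticAt.im_ofReal ?_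
    exact (((analyticAt_const.add analyticAt_id).clog (hadd c)).sub
      ((analyticAt_const.sub analyticAt_id).clog (hsub c))).div_const
  · have h1 := ((hasDerivAt_id (c : ℂ)).const_add β).clog (hadd c)
    have h2 := ((hasDerivAt_id (c : ℂ)).const_sub β).clog (hsub c)
    have h3 : HasDerivAt f _ (c : ℂ) := (h1.sub h2).div_const (2 * β)
    have h4 := h3.comp_ofReal
    have h5 := (Complex.imCLM.hasFDerivAt.comp_hasDerivAt c h4)
    refine h5.congr_deriv ?_
    have e1 := Complex.slitPlane_ne_zero (hadd c)
    have e2 := Complex.slitPlane_ne_zero (hsub c)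
    have e3 : (β + c) * (β - c) = ((r₀ - c ^ 2 : ℝ) : ℂ) - Complex.I := by
      push_cast; linear_combination hβ
    have e4 : (1 / (β + c) - -1 / (β - c)) / (2 * β) = 1 / (((r₀ - c ^ 2 : ℝ) : ℂ) - Complex.I) := by
      rw [← e3]; field_simp; ring
    simp only [id, Complex.imCLM_apply, e4]
    generalize r₀ - c ^ 2 = r
    simp [Complex.inv_im, Complex.normSq_apply]
    ring

/-- For `a = 0` the time is analytic in the parameter with positive derivative on the whole line, so
the parameter is an analytic function of the time up to and including the end of the fall. -/
lemma exists_analytic_fall_parameter {b r₀ : ℝ} (hb : 0 < b) (hr₀ : 0 < r₀) :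
    ∃ T : ℝ, 0 < T ∧ ∃ u : ℝ → ℝ, u 0 = 0 ∧ u T = √r₀ ∧ (∀ t ∈ Ico 0 T, u t ∈ Ico 0 √r₀) ∧
      (∀ t ∈ Ico 0 T, HasDerivAt u (fallTime 0 b r₀ (u t))⁻¹ t) ∧
      Tendsto u (𝓝[<] T) (𝓝[<] √r₀) ∧ ∀ t ∈ Icc 0 T, AnalyticAt ℝ u t := by
  set R := √r₀ with hRdef
  have hR : 0 < R := Real.sqrt_pos.2 hr₀
  obtain ⟨F, hF0, hFan, hF⟩ := exists_analytic_primitive r₀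
  set G : ℝ → ℝ := fun c => 2 / √(2 * b) * F c with hGdef
  have h2b : 0 < √(2 * b) := Real.sqrt_pos.2 (by positivity)
  have hkpos : ∀ c, 0 < fallTime 0 b r₀ c := fun c => by
    simp only [fallTime, fallSpeed, zero_div, zero_add]; positivity
  have hGan : ∀ c, AnalyticAt ℝ G c := fun c => analyticAt_const.mul (hFan c)
  have hGd : ∀ c, deriv G c = fallTime 0 b r₀ c := fun c => by
    refine (((hF c).const_mul (2 / √(2 * b))).congr_deriv ?_).deriv
    simp only [fallTime, fallSpeed, zero_div, zero_add]
    field_simp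
  have hG : ∀ c, HasStrictDerivAt G (fallTime 0 b r₀ c) c := fun c =>
    hGd c ▸ (hGan c).hasStrictDerivAt
  have hGc : Continuous G := continuous_iff_continuousAt.2 fun c => (hGan c).continuousAt
  have h0 : G 0 = 0 := by simp [hGdef, hF0]
  have hmono : StrictMono G := strictMono_of_deriv_pos fun c => by rw [hGd]; exact hkpos c
  have hinj : InjOn G univ := hmono.injective.injOn
  have hleft : ∀ c, Function.invFunOn G univ (G c) = c := fun c =>
    hinj.leftInvOn_invFunOn (mem_univ c)
  refine ⟨G R, h0 ▸ hmono hR, Function.invFunOn G univ, ?_, hleft R, fun t ht => ?_,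
    fun t ht => ?_, ?_, fun t ht => ?_⟩
  · conv_lhs => rw [← h0]
    exact hleft 0
  · obtain ⟨c, hc, rfl⟩ := exists_mem_Ico_eq hR hGc.continuousOn h0 ht
    rwa [hleft]
  · obtain ⟨c, hc, rfl⟩ := exists_mem_Ico_eq hR hGc.continuousOn h0 ht
    rw [hleft]
    exact hasDerivAt_invFunOn isOpen_univ hinj (hG c) (hkpos c).ne' (mem_univ c)
  · exact tendsto_invFunOn hinj (subset_univ _) hR (hmono.strictMonoOn _) hGc.continuousOn h0
  · obtain ⟨c, hc, rfl⟩ := intermediate_value_Icc hR.le hGc.continuousOn (by rwa [h0])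
    exact analyticAt_invFunOn isOpen_univ hinj (hGan c) (by rw [hGd]; exact (hkpos c).ne')
      (mem_univ c)

lemma analyticAt_fallConfig {r₀ t : ℝ} {u : ℝ → ℝ} (hu : AnalyticAt ℝ u t) :
    AnalyticAt ℝ (fun s => fallConfig r₀ (u s)) t := by
  have hθ : AnalyticAt ℝ (fun s => fallAngle r₀ (u s)) t :=
    (Real.contDiff_arctan.contDiffAt.analyticAt).fun_comp (analyticAt_const.sub (hu.pow 2))
  simp only [fallConfig, isoscelesConfig_eq]
  exact (((Real.analyticAt_sin.fun_comp hθ).smul analyticAt_const).add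
    ((Real.analyticAt_cos.fun_comp hθ).smul analyticAt_const)).add analyticAt_const

lemma exists_analytic_fall {m x₀ y₀ : ℝ} (hm : 0 < m) (hx₀ : 0 < x₀) (hy₀ : 0 < y₀)
    (h : x₀ ^ 2 + y₀ ^ 2 = 1) :
    ∃ T : ℝ, 0 < T ∧ ∃ q v : ℝ → Config 3,
      IsMaximalSphereSolution ![4 * m, 4 * m, m] (isoscelesConfig x₀ y₀) 0 (T : EReal) q v ∧
      (∀ t ∈ Ico 0 T, IsIsosceles (q t)) ∧
      Tendsto q (𝓝[<] T) (𝓝 (isoscelesConfig 0 1)) ∧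
      (∃ w : Config 3, Tendsto v (𝓝[<] T) (𝓝 w) ∧ w 0 ≠ 0 ∧ w 1 ≠ 0) ∧
      (∃ F : Config 3,
        Tendsto (fun t => gravForce ![4 * m, 4 * m, m] (q t)) (𝓝[<] T) (𝓝 F)) ∧
      ∃ Q : ℝ → Config 3, AnalyticOnNhd ℝ Q (Icc 0 T) ∧ EqOn Q q (Ico 0 T) ∧
        Q T = isoscelesConfig 0 1 := by
  have hr₀ : 0 < x₀ / y₀ := by positivity
  have hR : 0 < √(x₀ / y₀) := Real.sqrt_pos.2 hr₀
  obtain ⟨T, hT, u, hu0, huT, hmem, hu, hlim, hua⟩ := exists_analytic_fall_parameter hm hr₀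
  obtain ⟨hmax, hq⟩ := isMaximal_fall (M := 4 * m) (m := m) le_rfl hm (by ring)
    (by ring) hx₀ hy₀ h hT hu0 hmem hu hlim
  have hIco : Ico 0 T ∈ 𝓝[<] T := Ico_mem_nhdsLT hT
  have hlim' : Tendsto u (𝓝[<] T) (𝓝 √(x₀ / y₀)) := hlim.mono_right nhdsWithin_le_nhds
  have hθ : Tendsto (fun t => fallAngle (x₀ / y₀) (u t)) (𝓝[<] T) (𝓝 0) := by
    rw [← fallAngle_sqrt hr₀]
    exact ((continuous_fallAngle _).tendsto _).comp hlim'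
  have hsin : Tendsto (fun t => Real.sin (fallAngle (x₀ / y₀) (u t))) (𝓝[<] T) (𝓝 0) := by
    rw [← Real.sin_zero]; exact (Real.continuous_sin.tendsto _).comp hθ
  have hcos : Tendsto (fun t => Real.cos (fallAngle (x₀ / y₀) (u t))) (𝓝[<] T) (𝓝 1) := by
    rw [← Real.cos_zero]; exact (Real.continuous_cos.tendsto _).comp hθ
  have htan : Tendsto (fun t => isoscelesTangent (Real.sin (fallAngle (x₀ / y₀) (u t)))
      (Real.cos (fallAngle (x₀ / y₀) (u t)))) (𝓝[<] T) (𝓝 (isoscelesTangent 0 1)) :=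
    (continuous_isoscelesTangent.tendsto (0, 1)).comp (hsin.prodMk_nhds hcos)
  have hw : ∀ i : Fin 3, i ≠ 2 → (-(√(x₀ / y₀) * √(2 * m))) • isoscelesTangent 0 1 i ≠ 0 := by
    intro i hi
    have h2m : 0 < √(2 * m) := Real.sqrt_pos.2 (by positivity)
    refine smul_ne_zero (neg_ne_zero.2 (by positivity)) fun h0 => ?_
    have := norm_isoscelesTangent (x := 0) (y := 1) (by norm_num) hi
    simp [h0] at this
  refine ⟨T, hT, _, _, hmax, fun t ht => isIsosceles_fallConfig (sub_sq_pos_of_mem_Ico (hmem t ht)),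
    hq, ⟨(-(√(x₀ / y₀) * √(2 * m))) • isoscelesTangent 0 1, ?_, hw 0 (by decide),
      hw 1 (by decide)⟩, ⟨(4 * m * (-m)) • isoscelesTangent 0 1, ?_⟩,
    fun t => fallConfig (x₀ / y₀) (u t), fun t ht => analyticAt_fallConfig (hua t ht),
    fun t _ => rfl, by simp only [huT, fallConfig_sqrt hr₀]⟩
  · simp only [fallVelocity, fallSpeed, zero_div, zero_add]
    exact ((hlim'.mul_const _).neg).smul htan
  · have hc2 : Tendsto (fun t => 4 * m * (-m / Real.cos (fallAngle (x₀ / y₀) (u t)) ^ 2))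
        (𝓝[<] T) (𝓝 (4 * m * (-m / 1 ^ 2))) :=
      (tendsto_const_nhds.div (hcos.pow 2) (by norm_num)).const_mul _
    rw [one_pow, div_one] at hc2
    refine (hc2.smul htan).congr' ?_
    filter_upwards [hIco] with t ht
    have hr := sub_sq_pos_of_mem_Ico (hmem t ht)
    rw [gravForce_fallConfig _ _ hr]
    congr 2
    have hs := sin_arctan_sq_inv hr
    have hc := cos_arctan_sq_inv (x₀ / y₀ - u t ^ 2)
    rw [← fallAngle] at hs hc
    have e : m / Real.sin (fallAngle (x₀ / y₀) (u t)) ^ 2 - 4 * m /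
        (4 * Real.sin (fallAngle (x₀ / y₀) (u t)) ^ 2 * Real.cos (fallAngle (x₀ / y₀) (u t)) ^ 2)
        = m * ((1 / Real.sin (fallAngle (x₀ / y₀) (u t)) ^ 2) *
          (1 - 1 / Real.cos (fallAngle (x₀ / y₀) (u t)) ^ 2)) := by ring
    rw [e, neg_div, div_eq_mul_one_div m, hs, hc]
    generalize x₀ / y₀ - u t ^ 2 = r at hr
    field_simp
    ring

/-! ### Masses `2 m, 2 m, m`: repulsion -/

/-- The angle of the oscillation about `π / 4` with `cos 2θ = w₀ cos φ`, in terms of the phase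
`φ`. -/
noncomputable def oscAngle (w₀ φ : ℝ) : ℝ := Real.arccos (w₀ * Real.cos φ) / 2

/-- The value of `sin 2θ` at phase `φ`. -/
noncomputable def oscSin (w₀ φ : ℝ) : ℝ := √(1 - (w₀ * Real.cos φ) ^ 2)

/-- The factor `A` in the energy integral `θ' = w₀ sin φ A` of the oscillation. -/
noncomputable def oscSpeed (m w₀ φ : ℝ) : ℝ :=
  √(2 * m / (oscSin w₀ 0 * (oscSin w₀ φ ^ 2 + oscSin w₀ φ * oscSin w₀ 0)))

/-- The derivative of the time with respect to the phase. -/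
noncomputable def oscTime (m w₀ φ : ℝ) : ℝ := 1 / (2 * oscSin w₀ φ * oscSpeed m w₀ φ)

section Oscillation

variable {m w₀ : ℝ}

lemma sq_mul_cos_le (w₀ φ : ℝ) : (w₀ * Real.cos φ) ^ 2 ≤ w₀ ^ 2 := by
  rw [mul_pow]
  exact mul_le_of_le_one_right (sq_nonneg _) (Real.cos_sq_le_one φ)

lemma mul_cos_mem_Ioo (hw₀ : w₀ ∈ Ioo 0 1) (φ : ℝ) : w₀ * Real.cos φ ∈ Ioo (-1) 1 := by
  have h := sq_mul_cos_le w₀ φ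
  have h1 : w₀ ^ 2 < 1 := by nlinarith [hw₀.1, hw₀.2]
  exact abs_lt.1 ((sq_lt_one_iff_abs_lt_one _).1 (h.trans_lt h1))

lemma oscSin_pos (hw₀ : w₀ ∈ Ioo 0 1) (φ : ℝ) : 0 < oscSin w₀ φ := by
  have h := mul_cos_mem_Ioo hw₀ φ
  exact Real.sqrt_pos.2 (by nlinarith [h.1, h.2])

lemma oscSin_sq (hw₀ : w₀ ∈ Ioo 0 1) (φ : ℝ) :
    oscSin w₀ φ ^ 2 = 1 - (w₀ * Real.cos φ) ^ 2 := by
  have h := mul_cos_mem_Ioo hw₀ φ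
  exact Real.sq_sqrt (by nlinarith [h.1, h.2])

lemma oscSpeed_pos (hm : 0 < m) (hw₀ : w₀ ∈ Ioo 0 1) (φ : ℝ) : 0 < oscSpeed m w₀ φ := by
  have h1 := oscSin_pos hw₀ φ
  have h2 := oscSin_pos hw₀ 0
  exact Real.sqrt_pos.2 (by positivity)

lemma continuous_oscSin (w₀ : ℝ) : Continuous (oscSin w₀) := by
  unfold oscSin; fun_prop

lemma continuous_oscSpeed (hw₀ : w₀ ∈ Ioo 0 1) : Continuous (oscSpeed m w₀) := by
  have := continuous_oscSin w₀
  refine Real.continuous_sqrt.comp (continuous_const.div (by fun_prop) fun φ => ?_)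
  have h1 := oscSin_pos hw₀ φ
  have h2 := oscSin_pos hw₀ 0
  positivity

lemma oscAngle_mem (hw₀ : w₀ ∈ Ioo 0 1) (φ : ℝ) : oscAngle w₀ φ ∈ Ioo 0 (Real.pi / 2) := by
  have h := mul_cos_mem_Ioo hw₀ φ
  have h1 := Real.arccos_pos.2 h.2
  have h2 := Real.arccos_lt_pi.2 h.1
  constructor <;> unfold oscAngle <;> linarith

lemma cos_oscAngle_sq (hw₀ : w₀ ∈ Ioo 0 1) (φ : ℝ) :
    Real.cos (oscAngle w₀ φ) ^ 2 = (1 + w₀ * Real.cos φ) / 2 := by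
  have h := mul_cos_mem_Ioo hw₀ φ
  rw [Real.cos_sq, oscAngle, mul_div_cancel₀ _ two_ne_zero, Real.cos_arccos h.1.le h.2.le]
  ring

lemma sin_oscAngle_sq (hw₀ : w₀ ∈ Ioo 0 1) (φ : ℝ) :
    Real.sin (oscAngle w₀ φ) ^ 2 = (1 - w₀ * Real.cos φ) / 2 := by
  rw [Real.sin_sq, cos_oscAngle_sq hw₀]; ring

/-- If the phase runs at speed `1 / oscTime`, the angle satisfies the equation of motion. -/
lemma hasDerivAt_oscAngle (hm : 0 < m) (hw₀ : w₀ ∈ Ioo 0 1) {u : ℝ → ℝ} {t : ℝ}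
    (hu : HasDerivAt u (oscTime m w₀ (u t))⁻¹ t) :
    HasDerivAt (fun s => oscAngle w₀ (u s)) (w₀ * Real.sin (u t) * oscSpeed m w₀ (u t)) t ∧
    HasDerivAt (fun s => w₀ * Real.sin (u s) * oscSpeed m w₀ (u s))
      (m / Real.sin (oscAngle w₀ (u t)) ^ 2 - 2 * m /
        (4 * Real.sin (oscAngle w₀ (u t)) ^ 2 * Real.cos (oscAngle w₀ (u t)) ^ 2)) t := by
  have hA := oscSpeed_pos hm hw₀ (u t)
  have hs := oscSin_pos hw₀ (u t)
  have hs0 := oscSin_pos hw₀ 0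
  have hs2 := oscSin_sq hw₀ (u t)
  have hs02 := oscSin_sq hw₀ 0
  have hA2 : oscSpeed m w₀ (u t) ^ 2 =
      2 * m / (oscSin w₀ 0 * (oscSin w₀ (u t) ^ 2 + oscSin w₀ (u t) * oscSin w₀ 0)) :=
    Real.sq_sqrt (by positivity)
  have hw := mul_cos_mem_Ioo hw₀ (u t)
  have hcos := hu.cos.const_mul w₀
  have hsin : HasDerivAt (fun s => oscSin w₀ (u s)) _ t :=
    ((hcos.fun_pow 2).const_sub 1).sqrt (by rw [← hs2]; positivity)
  have hB := ((((hsin.fun_pow 2).fun_add (hsin.mul_const (oscSin w₀ 0))).const_mul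
    (oscSin w₀ 0)).fun_inv (by positivity)).const_mul (2 * m)
  have hB' : HasDerivAt (fun s => oscSpeed m w₀ (u s)) _ t :=
    (hB.sqrt (by positivity)).congr_of_eventuallyEq
      (Eventually.of_forall fun s => by simp only [oscSpeed, div_eq_mul_inv])
  have hθ := ((Real.hasDerivAt_arccos hw.1.ne' hw.2.ne).comp t hcos).div_const 2
  refine ⟨hθ.congr_deriv ?_, ((hu.sin.const_mul w₀).fun_mul hB').congr_deriv ?_⟩
  · rw [← oscSin, oscTime]
    field_simp
  · rw [sin_oscAngle_sq hw₀, cos_oscAngle_sq hw₀, ← oscSin, oscTime, ← div_eq_mul_inv (2 * m),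
      ← oscSpeed]
    have hsc := Real.sin_sq_add_cos_sq (u t)
    simp only [Real.cos_zero, mul_one] at hs02
    set A := oscSpeed m w₀ (u t)
    set s := oscSin w₀ (u t)
    set s0 := oscSin w₀ 0
    set w := w₀ * Real.cos (u t) with hwdef
    -- This is `w₀² sin² φ = w₀² - w²`.
    have hS : (w₀ * Real.sin (u t)) ^ 2 = (s - s0) * (s + s0) := by
      have : w ^ 2 = w₀ ^ 2 * Real.cos (u t) ^ 2 := by rw [hwdef, mul_pow]
      linear_combination hs02 - hs2 - this + w₀ ^ 2 * hsc
    have hrhs : m / ((1 - w) / 2) - 2 * m / (4 * ((1 - w) / 2) * ((1 + w) / 2))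
        = 2 * m * w / s ^ 2 := by
      have h1 : 1 - w ≠ 0 := by linarith [hw.2]
      have h2 : 1 + w ≠ 0 := by linarith [hw.1]
      rw [hs2, show 1 - w ^ 2 = (1 - w) * (1 + w) by ring]
      field_simp; ring
    rw [hrhs, ← mul_assoc w₀ (Real.cos (u t)), ← hwdef]
    trans 2 * s * w * A ^ 2 - 2 * m * (2 * s + s0) * w * (w₀ * Real.sin (u t)) ^ 2 /
      (s0 * s ^ 2 * (s + s0) ^ 2)
    · field_simp; push_cast; ring
    · rw [hA2, hS]; field_simp; ring

/-- The phase `u` as a function of the time, inverse to the time `G` as a function of the phase. -/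
lemma exists_osc_phase (hm : 0 < m) (hw₀ : w₀ ∈ Ioo 0 1) :
    ∃ G u : ℝ → ℝ, StrictMono G ∧ G 0 = 0 ∧ (∀ c, u (G c) = c) ∧
      (∀ t, 0 ≤ t → ∃ c, G c = t) ∧
      ∀ t, 0 ≤ t → HasDerivAt u (oscTime m w₀ (u t))⁻¹ t := by
  have hpos : ∀ c, 0 < oscTime m w₀ c := fun c => by
    have h1 := oscSin_pos hw₀ c
    have h2 := oscSpeed_pos hm hw₀ c
    simp only [oscTime]; positivity
  have hkc : Continuous (oscTime m w₀) := by
    refine continuous_const.div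
      ((continuous_const.mul (continuous_oscSin w₀)).mul (continuous_oscSpeed hw₀)) fun c => ?_
    have h1 := oscSin_pos hw₀ c
    have h2 := oscSpeed_pos hm hw₀ c
    positivity
  set G : ℝ → ℝ := fun c => ∫ x in (0 : ℝ)..c, oscTime m w₀ x with hGdef
  have hG : ∀ c, HasStrictDerivAt G (oscTime m w₀ c) c := fun c =>
    hkc.integral_hasStrictDerivAt 0 c
  have hGc : Continuous G := continuous_iff_continuousAt.2 fun c => (hG c).hasDerivAt.continuousAt
  have h0 : G 0 = 0 := by simp [hGdef]
  have hmono : StrictMono G := strictMono_of_deriv_pos fun c => by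
    rw [(hG c).hasDerivAt.deriv]; exact hpos c
  have hinj : InjOn G univ := hmono.injective.injOn
  have hleft : ∀ c, Function.invFunOn G univ (G c) = c := fun c =>
    hinj.leftInvOn_invFunOn (mem_univ c)
  -- The time per unit of phase is bounded below, so the phase is defined for all times.
  have hs0 := oscSin_pos hw₀ 0
  set C : ℝ := 1 / (2 * 1 * √(2 * m / (oscSin w₀ 0 * (oscSin w₀ 0 * oscSin w₀ 0)))) with hC
  have hC0 : 0 < C := by
    have : 0 < √(2 * m / (oscSin w₀ 0 * (oscSin w₀ 0 * oscSin w₀ 0))) :=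
      Real.sqrt_pos.2 (by positivity)
    positivity
  have hCle : ∀ c, C ≤ oscTime m w₀ c := fun c => by
    have h1 := oscSin_pos hw₀ c
    have h2 := oscSpeed_pos hm hw₀ c
    have h3 : oscSin w₀ c ≤ 1 :=
      Real.sqrt_le_one.2 (by linarith [sq_nonneg (w₀ * Real.cos c)])
    have h4 : oscSin w₀ 0 ≤ oscSin w₀ c := Real.sqrt_le_sqrt (by
      rw [Real.cos_zero, mul_one]
      linarith [sq_mul_cos_le w₀ c])
    refine one_div_le_one_div_of_le (by positivity) ?_
    unfold oscSpeed
    gcongr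
    nlinarith
  have hgrow : ∀ c, 0 ≤ c → C * c ≤ G c := fun c hc => by
    have := mul_sub_le_image_sub_of_le_deriv (f := G)
      (fun x => (hG x).hasDerivAt.differentiableAt)
      (fun x => by rw [(hG x).hasDerivAt.deriv]; exact hCle x) hc
    simpa [h0] using this
  have hsurj : ∀ t, 0 ≤ t → ∃ c, G c = t := fun t ht => by
    have hle : t ≤ G (t / C) := by
      have := hgrow (t / C) (by positivity)
      rwa [mul_div_cancel₀ _ hC0.ne'] at this
    obtain ⟨c, -, hc⟩ := intermediate_value_Icc (a := 0) (b := t / C) (by positivity)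
      hGc.continuousOn ⟨by rwa [h0], hle⟩
    exact ⟨c, hc⟩
  refine ⟨G, Function.invFunOn G univ, hmono, h0, hleft, hsurj, fun t ht => ?_⟩
  obtain ⟨c, rfl⟩ := hsurj t ht
  rw [hleft]
  exact hasDerivAt_invFunOn isOpen_univ hinj (hG c) (hpos c).ne' (mem_univ c)

/-- The positions along the oscillation. -/
noncomputable def oscConfig (w₀ φ : ℝ) : Config 3 :=
  isoscelesConfig (Real.sin (oscAngle w₀ φ)) (Real.cos (oscAngle w₀ φ))

lemma dist_oscConfig (hw₀ : w₀ ∈ Ioo 0 1) (φ : ℝ) :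
    dist (oscConfig w₀ φ) (isoscelesConfig 0 1)
      = √(2 - 2 * √((1 + w₀ * Real.cos φ) / 2)) := by
  have h := oscAngle_mem hw₀ φ
  rw [oscConfig, dist_isoscelesConfig (Real.sin_sq_add_cos_sq _), ← cos_oscAngle_sq hw₀,
    Real.sqrt_sq (Real.cos_pos_of_mem_Ioo ⟨by linarith [h.1, Real.pi_pos], h.2⟩).le]

lemma dist_oscConfig_lt (hw₀ : w₀ ∈ Ioo 0 1) {φ ψ : ℝ} (h : Real.cos ψ < Real.cos φ) :
    dist (oscConfig w₀ φ) (isoscelesConfig 0 1) < dist (oscConfig w₀ ψ) (isoscelesConfig 0 1) := by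
  have h1 := mul_cos_mem_Ioo hw₀ φ
  have h2 := mul_cos_mem_Ioo hw₀ ψ
  have h3 : √((1 + w₀ * Real.cos ψ) / 2) < √((1 + w₀ * Real.cos φ) / 2) :=
    Real.sqrt_lt_sqrt (by linarith [h2.1]) (by nlinarith [hw₀.1])
  have h4 : √((1 + w₀ * Real.cos φ) / 2) ≤ 1 := Real.sqrt_le_one.2 (by linarith [h1.2])
  rw [dist_oscConfig hw₀, dist_oscConfig hw₀]
  exact Real.sqrt_lt_sqrt (by linarith) (by linarith)

lemma dist_oscConfig_zero_le (hw₀ : w₀ ∈ Ioo 0 1) (φ : ℝ) :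
    dist (oscConfig w₀ 0) (isoscelesConfig 0 1) ≤ dist (oscConfig w₀ φ) (isoscelesConfig 0 1) := by
  rcases (Real.cos_le_one φ).lt_or_eq with h | h
  · exact (dist_oscConfig_lt hw₀ (by rwa [Real.cos_zero])).le
  · rw [dist_oscConfig hw₀, dist_oscConfig hw₀, h, Real.cos_zero]

lemma exists_repelled {x₀ y₀ : ℝ} (hm : 0 < m) (hx₀ : 0 < x₀) (hy₀ : 0 < y₀)
    (h : x₀ ^ 2 + y₀ ^ 2 = 1) (hx : x₀ < √2 / 2) :
    ∃ q v : ℝ → Config 3,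
      IsMaximalSphereSolution ![2 * m, 2 * m, m] (isoscelesConfig x₀ y₀) 0 ⊤ q v ∧
      (∀ t, 0 ≤ t → IsIsosceles (q t)) ∧
      IsRepelledFrom q (isoscelesConfig 0 1) := by
  have hx2 : x₀ ^ 2 < 1 / 2 := by
    have h1 : x₀ ^ 2 < (√2 / 2) ^ 2 := by gcongr
    rw [div_pow, Real.sq_sqrt zero_le_two] at h1
    linarith
  have hw₀ : 1 - 2 * x₀ ^ 2 ∈ Ioo (0 : ℝ) 1 := ⟨by linarith, by have := pow_pos hx₀ 2; linarith⟩
  set w₀ := 1 - 2 * x₀ ^ 2 with hw₀def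
  obtain ⟨G, u, hmono, h0, hleft, hsurj, hu⟩ := exists_osc_phase hm hw₀
  have hu0 : u 0 = 0 := by simpa [h0] using hleft 0
  have hsol : IsSphereSolution ![2 * m, 2 * m, m] ⊤ (fun t => oscConfig w₀ (u t))
      (fun t => (w₀ * Real.sin (u t) * oscSpeed m w₀ (u t)) •
        isoscelesTangent (Real.sin (oscAngle w₀ (u t))) (Real.cos (oscAngle w₀ (u t)))) := by
    refine isSphereSolution_isosceles (θ := fun t => oscAngle w₀ (u t))
      (ω := fun t => w₀ * Real.sin (u t) * oscSpeed m w₀ (u t))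
      (by positivity) ?_ ?_ ?_ <;> rw [timeDomain_top] <;> intro t ht
    · exact oscAngle_mem hw₀ _
    · exact (hasDerivAt_oscAngle hm hw₀ (hu t ht)).1.hasDerivWithinAt
    · exact (hasDerivAt_oscAngle hm hw₀ (hu t ht)).2.hasDerivWithinAt
  have hq0 : oscConfig w₀ 0 = isoscelesConfig x₀ y₀ := by
    obtain ⟨a0, a1⟩ := oscAngle_mem hw₀ 0
    have hs : Real.sin (oscAngle w₀ 0) = x₀ := by
      rw [← sq_eq_sq₀ (Real.sin_pos_of_pos_of_lt_pi a0 (by linarith [Real.pi_pos])).le hx₀.le,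
        sin_oscAngle_sq hw₀, Real.cos_zero, hw₀def]
      ring
    have hc : Real.cos (oscAngle w₀ 0) = y₀ := by
      rw [← sq_eq_sq₀ (Real.cos_pos_of_mem_Ioo ⟨by linarith [Real.pi_pos], a1⟩).le hy₀.le,
        cos_oscAngle_sq hw₀, Real.cos_zero, hw₀def]
      linarith
    rw [oscConfig, hs, hc]
  have hmax := hsol.isMaximal_top
  simp only [hu0, hq0, Real.sin_zero, mul_zero, zero_mul, zero_smul] at hmax
  refine ⟨_, _, hmax, fun t _ => isIsosceles_sin_cos (oscAngle_mem hw₀ (u t)),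
    ⟨G Real.pi, h0 ▸ hmono Real.pi_pos, fun s hs t ht hst => ?_⟩, fun t _ => ?_⟩
  · obtain ⟨c, rfl⟩ := hsurj s hs.1
    obtain ⟨d, rfl⟩ := hsurj t ht.1
    have hc : 0 ≤ c := hmono.le_iff_le.1 (by rw [h0]; exact hs.1)
    have hd : d ≤ Real.pi := hmono.le_iff_le.1 ht.2
    simp only [hleft]
    exact dist_oscConfig_lt hw₀
      (Real.cos_lt_cos_of_nonneg_of_le_pi hc hd (hmono.lt_iff_lt.1 hst))
  · simp only [hu0]
    exact dist_oscConfig_zero_le hw₀ _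

end Oscillation

theorem mainTheorem2 (m : ℝ) (hm : 0 < m) :
    IsCollisionAntipodal (isoscelesConfig 0 1) ∧
    -- (i) masses `8m, 8m, m`: the motion ends in a collision-antipodal singularity
    (∃ δ > 0, ∀ x₀ y₀ : ℝ, 0 < x₀ → 0 < y₀ → x₀ ^ 2 + y₀ ^ 2 = 1 → x₀ < δ →
      ∃ T : ℝ, 0 < T ∧ ∃ q v : ℝ → Config 3,
        IsMaximalSphereSolution ![8 * m, 8 * m, m] (isoscelesConfig x₀ y₀) 0 (T : EReal) q v ∧
        (∀ t ∈ Ico 0 T, IsIsosceles (q t)) ∧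
        Tendsto q (𝓝[<] T) (𝓝 (isoscelesConfig 0 1)) ∧
        (∀ i : Fin 3, i ≠ 2 →
          Tendsto (fun t => ‖v t i‖) (𝓝[<] T) atTop ∧
          Tendsto (fun t => ‖gravForce ![8 * m, 8 * m, m] (q t) i‖) (𝓝[<] T) atTop) ∧
        ¬ ∃ Q : ℝ → Config 3, AnalyticAt ℝ Q T ∧ Q =ᶠ[𝓝[<] T] q) ∧
    -- (ii) masses `2m, 2m, m`: the motion is repelled from the singularity
    (∀ x₀ y₀ : ℝ, 0 < x₀ → 0 < y₀ → x₀ ^ 2 + y₀ ^ 2 = 1 → x₀ < √2 / 2 →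
      ∃ q v : ℝ → Config 3,
        IsMaximalSphereSolution ![2 * m, 2 * m, m] (isoscelesConfig x₀ y₀) 0 ⊤ q v ∧
        (∀ t, 0 ≤ t → IsIsosceles (q t)) ∧
        IsRepelledFrom q (isoscelesConfig 0 1)) ∧
    -- (iii) masses `4m, 4m, m`: the motion reaches the configuration and is analytic there
    (∀ x₀ y₀ : ℝ, 0 < x₀ → 0 < y₀ → x₀ ^ 2 + y₀ ^ 2 = 1 → x₀ < 1 / √3 →
      ∃ T : ℝ, 0 < T ∧ ∃ q v : ℝ → Config 3,
        IsMaximalSphereSolution ![4 * m, 4 * m, m] (isoscelesConfig x₀ y₀) 0 (T : EReal) q v ∧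
        (∀ t ∈ Ico 0 T, IsIsosceles (q t)) ∧
        Tendsto q (𝓝[<] T) (𝓝 (isoscelesConfig 0 1)) ∧
        (∃ w : Config 3, Tendsto v (𝓝[<] T) (𝓝 w) ∧ w 0 ≠ 0 ∧ w 1 ≠ 0) ∧
        (∃ F : Config 3,
          Tendsto (fun t => gravForce ![4 * m, 4 * m, m] (q t)) (𝓝[<] T) (𝓝 F)) ∧
        ∃ Q : ℝ → Config 3, AnalyticOnNhd ℝ Q (Icc 0 T) ∧ EqOn Q q (Ico 0 T) ∧
          Q T = isoscelesConfig 0 1) := by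
  refine ⟨isCollisionAntipodal_isosceles, ?_, ?_, ?_⟩
  -- For masses `8 m, 8 m, m` every isosceles motion released at rest ends in the singularity.
  · exact ⟨1, one_pos, fun x₀ y₀ hx₀ hy₀ h _ => exists_fall_into_singularity hm hx₀ hy₀ h⟩
  · exact fun x₀ y₀ hx₀ hy₀ h hx => exists_repelled hm hx₀ hy₀ h hx
  · exact fun x₀ y₀ hx₀ hy₀ h _ => exists_analytic_fall hm hx₀ hy₀ h
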